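/- For $N\in\mathbb{N}$ and $W\in(0,\tfrac12)$ let $\mathbf{B}_{N,W}$ be the $N\times N$ prolate matrix with entries $\mathbf{B}_{N,W}[m,n]=\frac{\sin(2\pi W(m-n))}{\pi(m-n)}$ for $m\neq n$ and $\mathbf{B}_{N,W}[n,n]=2W$, $m,n\in\{0,\dots,N-1\}$. The discrete prolate spheroidal sequence (DPSS) vectors $\mathbf{s}_0,\dots,\mathbf{s}_{N-1}\in\mathbb{C}^N$ are an orthonormal basis of eigenvectors of $\mathbf{B}_{N,W}$, ordered so that the corresponding eigenvalues are nonincreasing. For $K\le N$ let $[\mathbf{S}]_K=[\mathbf{s}_0\ \cdots\ \mathbf{s}_{K-1}]$ be the $N\times K$ matrix of the first $K$ DPSS vectors, and for $f\in\mathbb{R}$ let $\mathbf{e}_f=(e^{2\pi i f n})_{n=0}^{N-1}\in\mathbb{C}^N$. Theorem. There is an absolute constant $C>0$ such that for every integer $N\ge 2$, every $W\in(0,\tfrac12)$ and every $\epsilon\in(0,\tfrac12)$ there is an integer $0\le K\le N$ with $$|K-2NW|\le C\,\log(N)\,\log\!\left(\tfrac{1}{\epsilon^2}\right),$$ i.e.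 $K=2NW+O\!\left(\log(N)\log(1/\epsilon^2)\right)$, such that for every choice of the DPSS vectors $$\frac{\left\|\mathbf{e}_f-[\mathbf{S}]_K[\mathbf{S}]_K^*\mathbf{e}_f\right\|_2^2}{\|\mathbf{e}_f\|_2^2}\le\epsilon\qquad\text{for all } f\in[-W,W].$$ -/

import Mathlib

open scoped Matrix

noncomputable section

/-- The `N × N` prolate matrix, with entries `sin (2πW(m - n)) / (π(m - n))`
off the diagonal and the limiting value `2W` on the diagonal. -/
def prolateMatrix (N : ℕ) (W : ℝ) : Matrix (Fin N) (Fin N) ℂ :=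
  Matrix.of fun m n =>
    if m = n then ((2 * W : ℝ) : ℂ)
    else ((Real.sin (2 * Real.pi * W * ((m : ℝ) - (n : ℝ))) /
      (Real.pi * ((m : ℝ) - (n : ℝ))) : ℝ) : ℂ)

/-- `s 0, …, s (N - 1)` is a system of DPSS vectors: an orthonormal family of eigenvectors of the
prolate matrix, listed in order of nonincreasing eigenvalue. -/
def IsDPSS (N : ℕ) (W : ℝ) (s : Fin N → EuclideanSpace ℂ (Fin N)) : Prop :=
  Orthonormal ℂ s ∧
    ∃ ν : Fin N → ℝ, Antitone ν ∧
      ∀ l : Fin N, prolateMatrix N W *ᵥ (s l).ofLp = (ν l : ℂ) • (s l).ofLp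

/-- The `N × K` matrix whose columns are the first `K` vectors of the family `s`. -/
def firstColumns {N K : ℕ} (hK : K ≤ N) (s : Fin N → EuclideanSpace ℂ (Fin N)) :
    Matrix (Fin N) (Fin K) ℂ :=
  Matrix.of fun n k => s (Fin.castLE hK k) n

/-- The sampled complex exponential `n ↦ exp (2πifn)`, `n = 0, …, N - 1`. -/
def sampledExp (N : ℕ) (f : ℝ) : Fin N → ℂ :=
  fun n => Complex.exp (2 * Real.pi * Complex.I * f * (n : ℂ))

/-- The Euclidean norm on `ℂ^N`. -/
def l2norm {N : ℕ} (x : Fin N → ℂ) : ℝ := ‖(WithLp.toLp 2 x : EuclideanSpace ℂ (Fin N))‖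

end

/-! The residual `x` of `e_f` is its component along the DPSS vectors of index at least `K`, so
`⟨e_f, x⟩ = ‖x‖²`: its trigonometric polynomial takes the value `R = ‖x‖²` at the band point `-f`.
Its band energy is a quadratic form of the prolate matrix, hence at most `ν K * R`. A polynomial
that reaches `R` at one point stays above `R / 2` nearby, so a tiny `ν K` forces `R ≤ ε N`
(`sum_norm_sq_le_of_integral_le`).

The bound on `ν K` (`dpss_eigenvalue_le`) is a min-max argument on the multiples `p = A B g` of a
fixed polynomial, with `A` an `edgeProd` and `B` the `bandNodePoly`. Let `q` be `p` with the sign of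
`t` flipped in `A`. In the band the two sines of each edge factor have opposite signs, and `|p| ≤
3⁻ᵐ |q|`; outside the enlarged band they have the same sign, and `|q| ≤ |p|`. Since `B` kills the
grid points where the latter may fail, Parseval on the grid gives `‖q‖ ≤ ‖p‖`, so `p` has relative
band energy at most `9⁻ᵐ`. The codimension is `m J` plus the number of nodes, with `J = O(log N)`,
`m = O(log (1/ε²))` and `2NW + O(1)` nodes. -/

/-! ### Trigonometric polynomials: band energy and Parseval identities -/

noncomputable section

/-- The trigonometric polynomial `f ↦ ∑ n, x n * exp (2πifn)` with coefficient vector `x`. -/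
def trigSum {N : ℕ} (x : Fin N → ℂ) (f : ℝ) : ℂ :=
  ∑ n, x n * sampledExp N f n

end

open Complex

theorem sampledExp_eq {N : ℕ} (f : ℝ) (n : Fin N) :
    sampledExp N f n = exp (((2 * Real.pi * n * f : ℝ) : ℂ) * I) := by
  rw [sampledExp]; congr 1; push_cast; ring

theorem norm_sampledExp {N : ℕ} (f : ℝ) (n : Fin N) : ‖sampledExp N f n‖ = 1 := by
  rw [sampledExp_eq, norm_exp_ofReal_mul_I]

theorem continuous_sampledExp {N : ℕ} (n : Fin N) :
    Continuous fun f : ℝ => sampledExp N f n := by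
  unfold sampledExp; fun_prop

theorem continuous_trigSum {N : ℕ} (x : Fin N → ℂ) : Continuous (trigSum x) := by
  unfold trigSum
  exact continuous_finsetSum _ fun n _ => continuous_const.mul (continuous_sampledExp n)

theorem intervalIntegrable_norm_sq_trigSum {N : ℕ} (x : Fin N → ℂ) (a b : ℝ) :
    IntervalIntegrable (fun f => ‖trigSum x f‖ ^ 2) MeasureTheory.volume a b :=
  Continuous.intervalIntegrable (by have := continuous_trigSum x; fun_prop) a b

theorem star_sampledExp_mul {N : ℕ} (f : ℝ) (m n : Fin N) :
    star (sampledExp N f m) * sampledExp N f n =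
      exp ((2 * Real.pi * ((n : ℝ) - (m : ℝ)) * I : ℂ) * f) := by
  rw [sampledExp_eq, sampledExp_eq, star_def, ← exp_conj, ← exp_add]
  congr 1
  simp only [map_mul, conj_ofReal, conj_I]
  push_cast; ring

theorem norm_sq_trigSum {N : ℕ} (x : Fin N → ℂ) (f : ℝ) :
    ((‖trigSum x f‖ ^ 2 : ℝ) : ℂ) =
      ∑ m, ∑ n, star (x m) * x n * (star (sampledExp N f m) * sampledExp N f n) := by
  have : ((‖trigSum x f‖ ^ 2 : ℝ) : ℂ) = star (trigSum x f) * trigSum x f := by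
    rw [star_def, conj_mul']; push_cast; rfl
  rw [this, trigSum, star_sum, Finset.sum_mul_sum]
  refine Finset.sum_congr rfl fun m _ => Finset.sum_congr rfl fun n _ => ?_
  rw [star_mul']; ring

theorem integral_star_sampledExp_mul {N : ℕ} (W : ℝ) (m n : Fin N) :
    ∫ f in (-W)..W, star (sampledExp N f m) * sampledExp N f n = prolateMatrix N W m n := by
  simp only [star_sampledExp_mul]
  by_cases h : m = n
  · subst h
    simp [prolateMatrix, two_mul]
  have hd : (m : ℂ) - (n : ℂ) ≠ 0 := by
    intro h0
    apply h
    have : (m : ℂ) = n := sub_eq_zero.1 h0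
    exact Fin.ext (by exact_mod_cast this)
  have hd' : (n : ℂ) - (m : ℂ) ≠ 0 := fun h0 => hd (by rw [← neg_sub, h0, neg_zero])
  have hpi : (Real.pi : ℂ) ≠ 0 := by exact_mod_cast Real.pi_ne_zero
  rw [integral_exp_mul_complex]
  · simp only [prolateMatrix, Matrix.of_apply, if_neg h]
    push_cast
    rw [Complex.sin]
    have e1 : (2 * Real.pi * ((n : ℂ) - m) * I * W : ℂ) = -(2 * Real.pi * W * (m - n)) * I := by
      ring
    have e2 : (2 * Real.pi * ((n : ℂ) - m) * I * -W : ℂ) = (2 * Real.pi * W * (m - n)) * I := by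
      ring
    rw [e1, e2]
    field_simp
    rw [I_sq]
    ring
  · push_cast
    exact mul_ne_zero (mul_ne_zero (mul_ne_zero two_ne_zero hpi) hd') I_ne_zero

/-- The energy of a trigonometric polynomial in the band `[-W, W]` is the quadratic form of the
prolate matrix. -/
theorem integral_norm_sq_trigSum {N : ℕ} (x : Fin N → ℂ) (W : ℝ) :
    ((∫ f in (-W)..W, ‖trigSum x f‖ ^ 2 : ℝ) : ℂ) = star x ⬝ᵥ (prolateMatrix N W *ᵥ x) := by
  rw [← intervalIntegral.integral_ofReal]
  simp only [norm_sq_trigSum]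
  have hc : ∀ m n : Fin N, Continuous fun f : ℝ =>
      star (x m) * x n * (star (sampledExp N f m) * sampledExp N f n) := fun m n =>
    continuous_const.mul ((continuous_sampledExp m).star.mul (continuous_sampledExp n))
  rw [intervalIntegral.integral_finsetSum fun m _ =>
    (continuous_finsetSum _ fun n _ => hc m n).intervalIntegrable _ _]
  simp only [dotProduct, Matrix.mulVec]
  refine Finset.sum_congr rfl fun m _ => ?_
  rw [intervalIntegral.integral_finsetSum fun n _ => (hc m n).intervalIntegrable _ _,
    Finset.mul_sum]
  refine Finset.sum_congr rfl fun n _ => ?_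
  rw [intervalIntegral.integral_const_mul, integral_star_sampledExp_mul, Pi.star_apply]
  ring

/-- The full-period case, which turns the band energy formula into Parseval's identity. -/
theorem prolateMatrix_one_half (N : ℕ) : prolateMatrix N (1 / 2) = 1 := by
  ext m n
  by_cases h : m = n
  · subst h; simp [prolateMatrix]
  · have : Real.sin (2 * Real.pi * (1 / 2) * ((m : ℝ) - n)) = 0 := by
      have := Real.sin_int_mul_pi ((m : ℤ) - (n : ℤ))
      push_cast at this
      rw [← this]; congr 1; ring
    simp only [prolateMatrix, Matrix.of_apply, if_neg h, this, Matrix.one_apply_ne h]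
    simp

theorem star_dotProduct_self {N : ℕ} (x : Fin N → ℂ) :
    star x ⬝ᵥ x = ((∑ n, ‖x n‖ ^ 2 : ℝ) : ℂ) := by
  simp only [dotProduct, Pi.star_apply, star_def, conj_mul']
  push_cast; rfl

/-- Parseval's identity for trigonometric polynomials. -/
theorem integral_norm_sq_trigSum_period {N : ℕ} (x : Fin N → ℂ) :
    ∫ f in (-(1 / 2 : ℝ))..(1 / 2), ‖trigSum x f‖ ^ 2 = ∑ n, ‖x n‖ ^ 2 := by
  have := integral_norm_sq_trigSum x (1 / 2)
  rw [prolateMatrix_one_half, Matrix.one_mulVec, star_dotProduct_self] at this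
  exact_mod_cast this

theorem integral_norm_sq_trigSum_le {N : ℕ} (x : Fin N → ℂ) {W : ℝ} (hW0 : 0 ≤ W)
    (hW : W ≤ 1 / 2) : ∫ f in (-W)..W, ‖trigSum x f‖ ^ 2 ≤ ∑ n, ‖x n‖ ^ 2 := by
  rw [← integral_norm_sq_trigSum_period]
  refine intervalIntegral.integral_mono_interval (by linarith) (by linarith) hW
    (Filter.Eventually.of_forall fun f => by positivity)
    (intervalIntegrable_norm_sq_trigSum x _ _)

theorem norm_sq_trigSum_le {N : ℕ} (x : Fin N → ℂ) (f : ℝ) :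
    ‖trigSum x f‖ ^ 2 ≤ N * ∑ n, ‖x n‖ ^ 2 := by
  have h1 : ‖trigSum x f‖ ≤ ∑ n, ‖x n‖ := by
    refine (norm_sum_le _ _).trans (Finset.sum_le_sum fun n _ => ?_)
    rw [norm_mul, norm_sampledExp, mul_one]
  calc ‖trigSum x f‖ ^ 2 ≤ (∑ n, ‖x n‖) ^ 2 := by gcongr
    _ ≤ N * ∑ n, ‖x n‖ ^ 2 := by
      simpa using sq_sum_le_card_mul_sum_sq (s := Finset.univ) (f := fun n => ‖x n‖)

/-- Sharper than the Parseval bound when `W` is below `1 / (2N)`; needed for uniformity as `W → 0`.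
-/
theorem integral_norm_sq_trigSum_le_mul {N : ℕ} (x : Fin N → ℂ) {W : ℝ} (hW0 : 0 ≤ W) :
    ∫ f in (-W)..W, ‖trigSum x f‖ ^ 2 ≤ 2 * N * W * ∑ n, ‖x n‖ ^ 2 := by
  have h := intervalIntegral.integral_mono_on (a := -W) (b := W) (μ := MeasureTheory.volume)
    (by linarith) (intervalIntegrable_norm_sq_trigSum x _ _)
    (intervalIntegrable_const (c := (N : ℝ) * ∑ n, ‖x n‖ ^ 2)) fun f _ => norm_sq_trigSum_le x f
  rw [intervalIntegral.integral_const, smul_eq_mul] at h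
  linarith

/-- Parseval's identity on the grid `k / N`. -/
theorem sum_norm_sq_trigSum_grid {N : ℕ} (x : Fin N → ℂ) :
    ∑ k ∈ Finset.range N, ‖trigSum x (k / N)‖ ^ 2 = N * ∑ n, ‖x n‖ ^ 2 := by
  rcases Nat.eq_zero_or_pos N with rfl | hN
  · simp
  have hN' : (N : ℂ) ≠ 0 := by exact_mod_cast hN.ne'
  have key : ∀ m n : Fin N, ∑ k ∈ Finset.range N,
      star (sampledExp N ((k : ℝ) / N) m) * sampledExp N ((k : ℝ) / N) n =
        if m = n then (N : ℂ) else 0 := by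
    intro m n
    simp only [star_sampledExp_mul]
    split_ifs with h
    · subst h; simp
    -- `z` is an `N`-th root of unity, different from `1` because `0 < |n - m| < N`, so its
    -- geometric sum vanishes.
    · set z : ℂ := exp (2 * Real.pi * ((n : ℝ) - (m : ℝ)) * I / N) with hz
      have e : ∀ k : ℕ, exp ((2 * Real.pi * ((n : ℝ) - (m : ℝ)) * I : ℂ) * ((k / N : ℝ) : ℂ))
          = z ^ k := by
        intro k; rw [hz, ← exp_nat_mul]; congr 1; push_cast; field_simp
      simp only [e]
      have hzN : z ^ N = 1 := by
        rw [hz, ← exp_nat_mul]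
        refine exp_eq_one_iff.2 ⟨(n : ℤ) - (m : ℤ), ?_⟩
        push_cast; field_simp
      have hz1 : z ≠ 1 := by
        intro h1
        obtain ⟨c, hc⟩ := exp_eq_one_iff.1 h1
        have hpi : (Real.pi : ℂ) ≠ 0 := by exact_mod_cast Real.pi_ne_zero
        have hI := I_ne_zero
        have h2 : ((n : ℂ) - m) = c * N := by
          push_cast at hc
          field_simp at hc
          linear_combination hc
        have h3 : ((n : ℤ) - (m : ℤ)) = c * N := by exact_mod_cast h2
        have hn := n.2
        have hm := m.2
        apply h
        apply Fin.ext
        have hc0 : c = 0 := by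
          by_contra hc0
          rcases lt_or_gt_of_ne hc0 with hc1 | hc1
          · have : c * N ≤ -1 * N := by gcongr; omega
            omega
          · have : 1 * (N : ℤ) ≤ c * N := by gcongr; omega
            omega
        rw [hc0] at h3
        omega
      have := geom_sum_eq hz1 N
      rw [this, hzN, sub_self, zero_div]
  have : ((∑ k ∈ Finset.range N, ‖trigSum x (k / N)‖ ^ 2 : ℝ) : ℂ) =
      ((N * ∑ n, ‖x n‖ ^ 2 : ℝ) : ℂ) := by
    rw [ofReal_sum]
    simp only [norm_sq_trigSum]
    rw [Finset.sum_comm]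
    simp only [Finset.sum_comm (s := Finset.range N), ← Finset.mul_sum, key]
    simp only [mul_ite, mul_zero, Finset.sum_ite_eq, Finset.mem_univ, if_true]
    rw [ofReal_mul, ← star_dotProduct_self, dotProduct, ← Finset.sum_mul, mul_comm]
    rfl
  exact_mod_cast this

open Polynomial in
theorem trigSum_coeff {N : ℕ} {p : ℂ[X]} (hp : p.degree < N) (f : ℝ) :
    trigSum (fun n : Fin N => p.coeff n) f = p.eval (exp ((2 * Real.pi * f : ℝ) * I)) := by
  have h : ∀ n : Fin N, sampledExp N f n = exp ((2 * Real.pi * f : ℝ) * I) ^ (n : ℕ) := by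
    intro n
    rw [sampledExp_eq, ← exp_nat_mul]; congr 1; push_cast; ring
  simp only [trigSum, h]
  rw [Fin.sum_univ_eq_sum_range (fun n => p.coeff n * exp ((2 * Real.pi * f : ℝ) * I) ^ n) N]
  by_cases h0 : p = 0
  · simp [h0]
  · rw [eval_eq_sum_range' ((natDegree_lt_iff_degree_lt h0).2 hp)]

/-! ### Polynomials with little energy in the band -/

noncomputable section

open Polynomial

/-- The linear polynomial whose modulus at `exp (2πif)` is
`2 * |sin (π(f - V)) + t * sin (π(f + V))|`. -/
def edgeFactor (V t : ℝ) : ℂ[X] :=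
  C (exp (-(Real.pi * V : ℝ) * I)) * (X - C (exp ((2 * Real.pi * V : ℝ) * I))) +
    C ((t : ℂ) * exp ((Real.pi * V : ℝ) * I)) * (X - C (exp (-(2 * Real.pi * V : ℝ) * I)))

/-- A power of a product of `edgeFactor`s whose parameters form a geometric progression. -/
def edgeProd (V t : ℝ) (J m : ℕ) : ℂ[X] :=
  (∏ j ∈ Finset.range J, edgeFactor V (t * 2 ^ j)) ^ m

/-- The indices of the grid points `k / N` which lie, modulo one, in the band `(-V, V)`. -/
def bandNodes (N : ℕ) (V : ℝ) : Finset ℕ :=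
  open Classical in
  (Finset.range N).filter fun k => (k : ℝ) / N < V ∨ 1 - V < (k : ℝ) / N

/-- The monic polynomial vanishing at the grid points in the band. -/
def bandNodePoly (N : ℕ) (V : ℝ) : ℂ[X] :=
  ∏ k ∈ bandNodes N V, (X - C (exp ((2 * Real.pi * ((k : ℝ) / N) : ℝ) * I)))

end

open Polynomial

theorem norm_eval_edgeFactor (V t f : ℝ) :
    ‖(edgeFactor V t).eval (exp ((2 * Real.pi * f : ℝ) * I))‖ =
      2 * |Real.sin (Real.pi * (f - V)) + t * Real.sin (Real.pi * (f + V))| := by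
  have key : (edgeFactor V t).eval (exp ((2 * Real.pi * f : ℝ) * I)) =
      exp ((Real.pi * f : ℝ) * I) * (2 * I) *
        ((Real.sin (Real.pi * (f - V)) + t * Real.sin (Real.pi * (f + V)) : ℝ) : ℂ) := by
    have hs : ∀ x : ℝ, (2 * I) * ((Real.sin x : ℝ) : ℂ) = exp (x * I) - exp (-(x * I)) := by
      intro x
      rw [ofReal_sin, Complex.sin]
      ring_nf
      rw [I_sq]; ring
    have e : exp ((Real.pi * f : ℝ) * I) * (2 * I) *
        ((Real.sin (Real.pi * (f - V)) + t * Real.sin (Real.pi * (f + V)) : ℝ) : ℂ) =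
        exp ((Real.pi * f : ℝ) * I) * (2 * I * ((Real.sin (Real.pi * (f - V)) : ℝ) : ℂ)) +
        t * (exp ((Real.pi * f : ℝ) * I) *
          (2 * I * ((Real.sin (Real.pi * (f + V)) : ℝ) : ℂ))) := by
      push_cast; ring
    rw [e, hs, hs]
    simp only [edgeFactor, eval_add, eval_mul, eval_C, eval_sub, eval_X, mul_sub, ← exp_add,
      mul_assoc (t : ℂ)]
    push_cast
    ring_nf
  rw [key, norm_mul, norm_mul, norm_exp_ofReal_mul_I, norm_real, Real.norm_eq_abs]
  simp

theorem natDegree_edgeFactor_le (V t : ℝ) : (edgeFactor V t).natDegree ≤ 1 := by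
  unfold edgeFactor; compute_degree

/-- At `f = 1/2` both sines equal `cos (πV) > 0`, so the value there is nonzero. -/
theorem edgeFactor_ne_zero {V t : ℝ} (hV0 : 0 ≤ V) (hV : V < 1 / 2) (ht : 0 ≤ t) :
    edgeFactor V t ≠ 0 := by
  intro h
  have h1 := norm_eval_edgeFactor V t (1 / 2)
  have hpi := Real.pi_pos
  have e1 : Real.sin (Real.pi * (1 / 2 - V)) = Real.cos (Real.pi * V) := by
    rw [← Real.sin_pi_div_two_sub]; congr 1; ring
  have e2 : Real.sin (Real.pi * (1 / 2 + V)) = Real.cos (Real.pi * V) := by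
    rw [← Real.cos_sub_pi_div_two]; congr 1; ring
  have hc : 0 < Real.cos (Real.pi * V) :=
    Real.cos_pos_of_mem_Ioo ⟨by nlinarith, by nlinarith⟩
  rw [h, eval_zero, norm_zero, e1, e2, abs_of_nonneg (by positivity)] at h1
  have : 0 ≤ t * Real.cos (Real.pi * V) := by positivity
  linarith

theorem natDegree_edgeProd_le (V t : ℝ) (J m : ℕ) : (edgeProd V t J m).natDegree ≤ m * J := by
  refine natDegree_pow_le.trans (Nat.mul_le_mul_left m ?_)
  refine (natDegree_prod_le _ _).trans ?_
  refine (Finset.sum_le_sum fun j _ => natDegree_edgeFactor_le V _).trans ?_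
  simp

theorem edgeProd_ne_zero {V t : ℝ} (hV0 : 0 ≤ V) (hV : V < 1 / 2) (ht : 0 ≤ t) (J m : ℕ) :
    edgeProd V t J m ≠ 0 :=
  pow_ne_zero _ (Finset.prod_ne_zero_iff.2 fun j _ => edgeFactor_ne_zero hV0 hV (by positivity))

theorem norm_eval_edgeProd (V t f : ℝ) (J m : ℕ) :
    ‖(edgeProd V t J m).eval (exp ((2 * Real.pi * f : ℝ) * I))‖ =
      (∏ j ∈ Finset.range J, 2 * |Real.sin (Real.pi * (f - V)) +
        t * 2 ^ j * Real.sin (Real.pi * (f + V))|) ^ m := by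
  rw [edgeProd, eval_pow, norm_pow, eval_prod, norm_prod]
  simp only [norm_eval_edgeFactor]

/-- Both sines are nonnegative on `[V, 1 - V]`, so a minus sign between them can only cause
cancellation. -/
theorem norm_eval_edgeProd_neg_le {V t f : ℝ} (ht : 0 ≤ t) (hf : f ∈ Set.Icc V (1 - V))
    (hV : 0 ≤ V) (J m : ℕ) :
    ‖(edgeProd V (-t) J m).eval (exp ((2 * Real.pi * f : ℝ) * I))‖ ≤
      ‖(edgeProd V t J m).eval (exp ((2 * Real.pi * f : ℝ) * I))‖ := by
  rw [norm_eval_edgeProd, norm_eval_edgeProd]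
  obtain ⟨h1, h2⟩ := hf
  have hpi := Real.pi_pos
  have hs1 : 0 ≤ Real.sin (Real.pi * (f - V)) :=
    Real.sin_nonneg_of_nonneg_of_le_pi (by nlinarith) (by nlinarith)
  have hs2 : 0 ≤ Real.sin (Real.pi * (f + V)) :=
    Real.sin_nonneg_of_nonneg_of_le_pi (by nlinarith) (by nlinarith)
  refine pow_le_pow_left₀ (Finset.prod_nonneg fun _ _ => by positivity)
    (Finset.prod_le_prod (fun _ _ => by positivity) fun j _ => ?_) m
  have h3 : 0 ≤ t * 2 ^ j * Real.sin (Real.pi * (f + V)) := by positivity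
  rw [abs_of_nonneg (add_nonneg hs1 h3)]
  refine mul_le_mul_of_nonneg_left (abs_le.2 ⟨?_, ?_⟩) zero_le_two <;> linarith

theorem le_sin_pi_mul {x g : ℝ} (h0 : 0 ≤ g) (h1 : g ≤ x) (h2 : x ≤ 1 - g) :
    g ≤ Real.sin (Real.pi * x) := by
  have hpi := Real.pi_pos
  have key : ∀ y : ℝ, g ≤ y → y ≤ 1 / 2 → g ≤ Real.sin (Real.pi * y) := by
    intro y hy1 hy2
    have := Real.mul_le_sin (x := Real.pi * y) (by nlinarith) (by nlinarith)
    have e : 2 / Real.pi * (Real.pi * y) = 2 * y := by field_simp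
    linarith
  rcases le_total x (1 / 2) with h | h
  · exact key x h1 h
  · have := key (1 - x) (by linarith) (by linarith)
    rwa [show Real.pi * (1 - x) = Real.pi - Real.pi * x by ring, Real.sin_pi_sub] at this

/-- In the band each factor compares `|u - τv|` with `u + τv`, where `u, v > 0` are the moduli of
the sines. No ratio exceeds `1`, and one is at most `1/3` when some `τ` in the progression is within
a factor `2` of `u / v`. The margin `1 / N` keeps `u, v ≥ 1 / N`, so `u / v` lies in `[1 / N, N]`, a
range of about `2 log₂ N` dyadic scales. -/
theorem norm_eval_edgeProd_le {N J : ℕ} {W f : ℝ} (hN : 0 < N) (hJ : N ^ 2 < 2 ^ J)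
    (hV : W + 1 / N ≤ 1 / 2) (hf : f ∈ Set.Icc (-W) W) (m : ℕ) :
    ‖(edgeProd (W + 1 / N) (1 / N) J m).eval (exp ((2 * Real.pi * f : ℝ) * I))‖ ≤
      (1 / 3) ^ m *
        ‖(edgeProd (W + 1 / N) (-(1 / N)) J m).eval (exp ((2 * Real.pi * f : ℝ) * I))‖ := by
  obtain ⟨hf1, hf2⟩ := hf
  have hN' : (0 : ℝ) < N := by exact_mod_cast hN
  have hN0 : (0 : ℝ) < 1 / N := by positivity
  rw [norm_eval_edgeProd, norm_eval_edgeProd, ← mul_pow]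
  refine pow_le_pow_left₀ (Finset.prod_nonneg fun _ _ => by positivity) ?_ m
  have hu := le_sin_pi_mul (x := W + 1 / N - f) hN0.le (by linarith) (by linarith)
  have hv := le_sin_pi_mul (x := f + (W + 1 / N)) hN0.le (by linarith) (by linarith)
  have hu1 := Real.sin_le_one (Real.pi * (W + 1 / N - f))
  have hv1 := Real.sin_le_one (Real.pi * (f + (W + 1 / N)))
  have e : Real.sin (Real.pi * (f - (W + 1 / N))) = -Real.sin (Real.pi * (W + 1 / N - f)) := by
    rw [← Real.sin_neg]; congr 1; ring
  rw [e]
  set u := Real.sin (Real.pi * (W + 1 / N - f))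
  set v := Real.sin (Real.pi * (f + (W + 1 / N)))
  have hu0 : 0 < u := hN0.trans_le hu
  have hv0 : 0 < v := hN0.trans_le hv
  have hNu : 1 ≤ N * u := by
    have := mul_le_mul_of_nonneg_left hu hN'.le
    rwa [mul_one_div_cancel hN'.ne'] at this
  have hNv : 1 ≤ N * v := by
    have := mul_le_mul_of_nonneg_left hv hN'.le
    rwa [mul_one_div_cancel hN'.ne'] at this
  -- With `τ = 2 ^ i / N` this says `τv ≤ u < 2τv`, whence `u - τv ≤ (u + τv) / 3`.
  obtain ⟨i, hi1, hi2⟩ := exists_nat_pow_near (x := N * u / v) (y := (2 : ℝ))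
    ((one_le_div hv0).2 (by linarith)) one_lt_two
  have hiJ : i < J := by
    have h1 : N * u / v ≤ (N : ℝ) ^ 2 := by
      rw [div_le_iff₀ hv0]
      nlinarith
    have h2 : (2 : ℝ) ^ i < 2 ^ J := lt_of_le_of_lt (hi1.trans h1) (by exact_mod_cast hJ)
    exact (pow_lt_pow_iff_right₀ one_lt_two).1 h2
  have hle : ∀ j : ℕ, |(-u + 1 / N * 2 ^ j * v)| ≤ |(-u + -(1 / N) * 2 ^ j * v)| := by
    intro j
    have h3 : 0 ≤ 1 / (N : ℝ) * 2 ^ j * v := by positivity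
    rw [abs_of_nonpos (a := -u + -(1 / N) * 2 ^ j * v) (by linarith)]
    exact abs_le.2 ⟨by linarith, by linarith⟩
  have hi : |(-u + 1 / N * 2 ^ i * v)| ≤ 1 / 3 * |(-u + -(1 / N) * 2 ^ i * v)| := by
    have h3 : 0 ≤ 1 / (N : ℝ) * 2 ^ i * v := by positivity
    have h4 : 1 / (N : ℝ) * 2 ^ i * v ≤ u := by
      rw [le_div_iff₀ hv0] at hi1
      rw [mul_assoc, one_div, inv_mul_le_iff₀ hN']; exact hi1
    have h5 : u ≤ 2 * (1 / (N : ℝ) * 2 ^ i * v) := by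
      rw [div_lt_iff₀ hv0, pow_succ] at hi2
      have : u ≤ (N : ℝ)⁻¹ * (2 ^ i * 2 * v) := by
        rw [le_inv_mul_iff₀ hN']; exact hi2.le
      rw [one_div]; linarith
    rw [abs_of_nonpos (a := -u + -(1 / N) * 2 ^ i * v) (by linarith)]
    exact abs_le.2 ⟨by linarith, by linarith⟩
  rw [← Finset.mul_prod_erase _ _ (Finset.mem_range.2 hiJ),
    ← Finset.mul_prod_erase (Finset.range J) (fun j => 2 * |(-u + -(1 / N) * 2 ^ j * v)|)
      (Finset.mem_range.2 hiJ), ← mul_assoc]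
  refine mul_le_mul (by linarith) (Finset.prod_le_prod (fun _ _ => by positivity) fun j _ => ?_)
    (Finset.prod_nonneg fun _ _ => by positivity) (by positivity)
  have := hle j
  linarith

theorem monic_bandNodePoly (N : ℕ) (V : ℝ) : (bandNodePoly N V).Monic :=
  monic_prod_of_monic _ _ fun _ _ => monic_X_sub_C _

theorem natDegree_bandNodePoly (N : ℕ) (V : ℝ) :
    (bandNodePoly N V).natDegree = (bandNodes N V).card := by
  rw [bandNodePoly, natDegree_prod_of_monic _ _ fun _ _ => monic_X_sub_C _]
  simp

theorem eval_bandNodePoly {N k : ℕ} {V : ℝ} (hk : k ∈ bandNodes N V) :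
    (bandNodePoly N V).eval (exp ((2 * Real.pi * ((k : ℝ) / N) : ℝ) * I)) = 0 := by
  rw [bandNodePoly, eval_prod]
  exact Finset.prod_eq_zero hk (by simp)

/-- The nodes lie at the two ends of `0, …, N - 1`, at most `⌈N * V⌉₊` at each. -/
theorem card_bandNodes_le {N : ℕ} (hN : 0 < N) (V : ℝ) :
    (bandNodes N V).card ≤ 2 * ⌈N * V⌉₊ := by
  have hN' : (0 : ℝ) < N := by exact_mod_cast hN
  have hsub : bandNodes N V ⊆ Finset.range ⌈N * V⌉₊ ∪ Finset.Ico (N - ⌈N * V⌉₊) N := by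
    intro k hk
    simp only [bandNodes, Finset.mem_filter, Finset.mem_range] at hk
    obtain ⟨hkN, hk | hk⟩ := hk
    · refine Finset.mem_union_left _ (Finset.mem_range.2 (Nat.lt_ceil.2 ?_))
      rw [div_lt_iff₀ hN'] at hk; linarith
    · refine Finset.mem_union_right _ (Finset.mem_Ico.2 ⟨?_, hkN⟩)
      rw [lt_div_iff₀ hN'] at hk
      have h1 := Nat.le_ceil (N * V)
      have : (N : ℝ) ≤ (⌈N * V⌉₊ + k : ℕ) := by push_cast; linarith
      have : N ≤ ⌈N * V⌉₊ + k := by exact_mod_cast this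
      omega
  refine (Finset.card_le_card hsub).trans ((Finset.card_union_le _ _).trans ?_)
  simp only [Finset.card_range, Nat.card_Ico]
  omega

theorem degree_edgeProd_mul_lt {N J M m : ℕ} (V t : ℝ)
    (hM : m * J + (bandNodes N V).card + M ≤ N) {g : ℂ[X]} (hg : g.degree < M) :
    (edgeProd V t J m * bandNodePoly N V * g).degree < N := by
  by_cases h0 : edgeProd V t J m * bandNodePoly N V * g = 0
  · rw [h0, degree_zero]; exact WithBot.bot_lt_coe _
  rw [← natDegree_lt_iff_degree_lt h0]
  have hg' := (natDegree_lt_iff_degree_lt (right_ne_zero_of_mul h0)).2 hg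
  have h1 := natDegree_mul_le (p := edgeProd V t J m * bandNodePoly N V) (q := g)
  have h2 := natDegree_mul_le (p := edgeProd V t J m) (q := bandNodePoly N V)
  have h3 := natDegree_edgeProd_le V t J m
  rw [natDegree_bandNodePoly] at h2
  omega

/-- A space of polynomials of small codimension in which every element has little energy in the
band `[-W, W]`. -/
theorem integral_norm_sq_trigSum_edgeProd_le {N J M m : ℕ} {W : ℝ} (hN : 0 < N)
    (hJ : N ^ 2 < 2 ^ J) (hW : 0 ≤ W) (hV : W + 1 / N < 1 / 2)
    (hM : m * J + (bandNodes N (W + 1 / N)).card + M ≤ N) {g : ℂ[X]} (hg : g.degree < M)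
    {p : ℂ[X]} (hp : p = edgeProd (W + 1 / N) (1 / N) J m * bandNodePoly N (W + 1 / N) * g) :
    ∫ f in (-W)..W, ‖trigSum (fun n : Fin N => p.coeff n) f‖ ^ 2 ≤
      (1 / 9) ^ m * min 1 (2 * N * W) * ∑ n : Fin N, ‖p.coeff n‖ ^ 2 := by
  have hN' : (0 : ℝ) < N := by exact_mod_cast hN
  set q := edgeProd (W + 1 / N) (-(1 / N)) J m * bandNodePoly N (W + 1 / N) * g with hq
  have hpd : p.degree < N := hp ▸ degree_edgeProd_mul_lt _ _ hM hg
  have hqd : q.degree < N := degree_edgeProd_mul_lt _ _ hM hg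
  have hqp : ∑ n : Fin N, ‖q.coeff n‖ ^ 2 ≤ ∑ n : Fin N, ‖p.coeff n‖ ^ 2 := by
    refine le_of_mul_le_mul_left ?_ hN'
    rw [← sum_norm_sq_trigSum_grid fun n : Fin N => q.coeff n,
      ← sum_norm_sq_trigSum_grid fun n : Fin N => p.coeff n]
    refine Finset.sum_le_sum fun k hk => ?_
    rw [trigSum_coeff hpd, trigSum_coeff hqd, hp, hq]
    simp only [eval_mul, norm_mul]
    -- At a band node `p` and `q` both vanish; at every other node the sign flip decreases the
    -- modulus.
    by_cases hkb : k ∈ bandNodes N (W + 1 / N)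
    · rw [eval_bandNodePoly hkb]; simp
    · have hkf : (k : ℝ) / N ∈ Set.Icc (W + 1 / N) (1 - (W + 1 / N)) := by
        simp only [bandNodes, Finset.mem_filter, not_and, not_or, not_lt] at hkb
        exact hkb hk
      gcongr
      exact norm_eval_edgeProd_neg_le (by positivity) hkf (by positivity) J m
  have hpq : ∫ f in (-W)..W, ‖trigSum (fun n : Fin N => p.coeff n) f‖ ^ 2 ≤
      (1 / 9) ^ m * ∫ f in (-W)..W, ‖trigSum (fun n : Fin N => q.coeff n) f‖ ^ 2 := by
    rw [← intervalIntegral.integral_const_mul]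
    refine intervalIntegral.integral_mono_on (by linarith)
      (intervalIntegrable_norm_sq_trigSum _ _ _)
      ((intervalIntegrable_norm_sq_trigSum _ _ _).const_mul _) fun f hf => ?_
    rw [trigSum_coeff hpd, trigSum_coeff hqd, hp, hq]
    simp only [eval_mul, norm_mul, mul_pow]
    have h1 := norm_eval_edgeProd_le hN hJ hV.le hf m
    have h2 := pow_le_pow_left₀ (norm_nonneg _) h1 2
    rw [mul_pow, ← pow_mul, mul_comm m 2, pow_mul, show ((1 : ℝ) / 3) ^ 2 = 1 / 9 by norm_num]
      at h2
    rw [← mul_assoc, ← mul_assoc]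
    gcongr
  have hq1 : ∫ f in (-W)..W, ‖trigSum (fun n : Fin N => q.coeff n) f‖ ^ 2 ≤
      min 1 (2 * N * W) * ∑ n : Fin N, ‖q.coeff n‖ ^ 2 := by
    have hs : 0 ≤ ∑ n : Fin N, ‖q.coeff n‖ ^ 2 := by positivity
    rw [min_mul_of_nonneg _ _ hs, one_mul]
    have : (0 : ℝ) < 1 / N := by positivity
    exact le_min (integral_norm_sq_trigSum_le _ hW (by linarith))
      (integral_norm_sq_trigSum_le_mul _ hW)
  have hmin : 0 ≤ min 1 (2 * N * W) := le_min zero_le_one (by positivity)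
  calc _ ≤ _ := hpq
    _ ≤ (1 / 9) ^ m * (min 1 (2 * N * W) * ∑ n : Fin N, ‖p.coeff n‖ ^ 2) := by
      gcongr
      exact hq1.trans (by gcongr)
    _ = _ := by ring

/-! ### Decay of the prolate eigenvalues -/

theorem Orthonormal.norm_sq_sum_smul {ι E : Type*} [Fintype ι] [NormedAddCommGroup E]
    [InnerProductSpace ℂ E] {s : ι → E} (hs : Orthonormal ℂ s) (c : ι → ℂ) :
    ‖∑ l, c l • s l‖ ^ 2 = ∑ l, ‖c l‖ ^ 2 := by
  have h := hs.inner_sum c c Finset.univ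
  rw [inner_self_eq_norm_sq_to_K] at h
  simp only [conj_mul'] at h
  apply ofReal_injective
  push_cast
  exact h

/-- The band energy of a combination of orthonormal eigenvectors of the prolate matrix. -/
theorem integral_norm_sq_trigSum_eigenvectors {N : ℕ} {W : ℝ} {ι : Type*} [Fintype ι]
    {s : ι → EuclideanSpace ℂ (Fin N)} (hs : Orthonormal ℂ s) {ν : ι → ℝ}
    (hν : ∀ l, prolateMatrix N W *ᵥ (s l).ofLp = (ν l : ℂ) • (s l).ofLp) (c : ι → ℂ) :
    ∫ f in (-W)..W, ‖trigSum (∑ l, c l • s l).ofLp f‖ ^ 2 = ∑ l, ν l * ‖c l‖ ^ 2 := by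
  have hB : prolateMatrix N W *ᵥ (∑ l, c l • s l).ofLp = (∑ l, (ν l * c l) • s l).ofLp := by
    rw [WithLp.ofLp_sum, WithLp.ofLp_sum, Matrix.mulVec_sum]
    refine Finset.sum_congr rfl fun l _ => ?_
    rw [WithLp.ofLp_smul, WithLp.ofLp_smul, Matrix.mulVec_smul, hν, smul_smul, mul_comm]
  have h := integral_norm_sq_trigSum (∑ l, c l • s l).ofLp W
  rw [hB, dotProduct_comm, ← EuclideanSpace.inner_eq_star_dotProduct, hs.inner_sum] at h
  have e : ∀ l, (starRingEnd ℂ) (c l) * (ν l * c l) = ((ν l * ‖c l‖ ^ 2 : ℝ) : ℂ) := by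
    intro l
    rw [mul_left_comm, conj_mul']; push_cast; rfl
  simp only [e] at h
  exact_mod_cast h

/-- Courant–Fischer: the span of `s 0, …, s k` meets the low-energy multiples of `P` nontrivially,
and on that span the energy is at least `ν k` times the squared norm. -/
theorem dpss_eigenvalue_le {N J m : ℕ} {W : ℝ} (hN : 0 < N) (hJ : N ^ 2 < 2 ^ J) (hW : 0 ≤ W)
    (hV : W + 1 / N < 1 / 2) {s : Fin N → EuclideanSpace ℂ (Fin N)} (hs : Orthonormal ℂ s)
    {ν : Fin N → ℝ} (hanti : Antitone ν)
    (hν : ∀ l, prolateMatrix N W *ᵥ (s l).ofLp = (ν l : ℂ) • (s l).ofLp) {k : Fin N}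
    (hk : m * J + (bandNodes N (W + 1 / N)).card ≤ k) :
    ν k ≤ (1 / 9) ^ m * min 1 (2 * N * W) := by
  obtain ⟨M, hM⟩ : ∃ M, m * J + (bandNodes N (W + 1 / N)).card + M = N :=
    ⟨N - (m * J + (bandNodes N (W + 1 / N)).card), by have := k.2; omega⟩
  set P : ℂ[X] := edgeProd (W + 1 / N) (1 / N) J m * bandNodePoly N (W + 1 / N) with hP
  have hP0 : P ≠ 0 := mul_ne_zero (edgeProd_ne_zero (by positivity) hV (by positivity) _ _)
    (monic_bandNodePoly _ _).ne_zero
  let ι := {l : Fin N // l ∈ Finset.Iic k}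
  let L₁ : (ι → ℂ) →ₗ[ℂ] (Fin N → ℂ) := Fintype.linearCombination ℂ fun l : ι => (s l).ofLp
  let L₂ : degreeLT ℂ M →ₗ[ℂ] (Fin N → ℂ) :=
    (LinearMap.pi fun n : Fin N => lcoeff ℂ n) ∘ₗ LinearMap.mulLeft ℂ P ∘ₗ
      (degreeLT ℂ M).subtype
  -- The dimensions are `k + 1` and `M`, and their sum exceeds `N`; a kernel element is a common
  -- vector of the two ranges.
  have hker : LinearMap.ker (L₁.coprod (-L₂)) ≠ ⊥ := by
    refine LinearMap.ker_ne_bot_of_finrank_lt ?_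
    rw [Module.finrank_prod, Module.finrank_fintype_fun_eq_card,
      Module.finrank_fintype_fun_eq_card, (degreeLTEquiv ℂ M).finrank_eq,
      Module.finrank_fintype_fun_eq_card, Fintype.card_coe, Fin.card_Iic, Fintype.card_fin,
      Fintype.card_fin]
    omega
  obtain ⟨⟨c, g⟩, hcg, hne⟩ := Submodule.exists_mem_ne_zero_of_ne_bot hker
  have hLe : L₁ c = L₂ g := by
    rw [LinearMap.mem_ker, LinearMap.coprod_apply, LinearMap.neg_apply] at hcg
    exact add_neg_eq_zero.1 hcg
  set p : ℂ[X] := P * (g : ℂ[X]) with hp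
  have hgd : (g : ℂ[X]).degree < M := mem_degreeLT.1 g.2
  have hpd : p.degree < N := degree_edgeProd_mul_lt _ _ hM.le hgd
  have hx : (∑ l : ι, c l • s l).ofLp = fun n : Fin N => p.coeff n := by
    rw [WithLp.ofLp_sum]
    exact hLe
  have hsι : Orthonormal ℂ fun l : ι => s l := hs.comp _ Subtype.val_injective
  have hlow := integral_norm_sq_trigSum_edgeProd_le hN hJ hW hV hM.le hgd hp
  rw [← hx, integral_norm_sq_trigSum_eigenvectors hsι (fun l : ι => hν l)] at hlow
  have hnorm : ∑ n : Fin N, ‖p.coeff n‖ ^ 2 = ∑ l : ι, ‖c l‖ ^ 2 := by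
    rw [← hsι.norm_sq_sum_smul, EuclideanSpace.norm_sq_eq]
    exact Finset.sum_congr rfl fun n _ => by rw [congrFun hx n]
  rw [hnorm] at hlow
  -- If `c = 0` then `P * g = 0`, so `g = 0` because `P ≠ 0`, and the kernel element would be
  -- trivial.
  have hc : c ≠ 0 := by
    rintro rfl
    apply hne
    have h0 : ∑ n : Fin N, ‖p.coeff n‖ ^ 2 = 0 := by rw [hnorm]; simp
    have h1 : ∀ n : Fin N, p.coeff n = 0 := by
      intro n
      have := (Finset.sum_eq_zero_iff_of_nonneg fun _ _ => by positivity).1 h0 n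
        (Finset.mem_univ _)
      simpa using this
    have hpz : p = 0 := by
      ext n
      by_cases hn : n < N
      · exact h1 ⟨n, hn⟩
      · rw [coeff_zero]
        refine coeff_eq_zero_of_degree_lt (hpd.trans_le ?_)
        exact_mod_cast not_lt.1 hn
    have hg0 : g = 0 := Subtype.ext ((mul_eq_zero.1 hpz).resolve_left hP0)
    rw [hg0]; rfl
  have hpos : 0 < ∑ l : ι, ‖c l‖ ^ 2 := by
    obtain ⟨l, hl⟩ := Function.ne_iff.1 hc
    refine Finset.sum_pos' (fun _ _ => by positivity) ⟨l, Finset.mem_univ _, ?_⟩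
    have : 0 < ‖c l‖ := norm_pos_iff.2 hl
    positivity
  refine le_of_mul_le_mul_right (le_trans ?_ hlow) hpos
  rw [Finset.mul_sum]
  refine Finset.sum_le_sum fun l _ => ?_
  gcongr
  exact hanti (Finset.mem_Iic.1 l.2)

/-! ### From small band energy to a pointwise bound -/

theorem norm_sampledExp_sub_le {N : ℕ} (f f' : ℝ) (n : Fin N) :
    ‖sampledExp N f n - sampledExp N f' n‖ ≤ 2 * Real.pi * N * |f - f'| := by
  have e : sampledExp N f n - sampledExp N f' n =
      sampledExp N f' n * (exp (I * ((2 * Real.pi * n * (f - f') : ℝ) : ℂ)) - 1) := by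
    rw [mul_sub, mul_one, sampledExp_eq, sampledExp_eq, ← exp_add]
    congr 2; push_cast; ring
  rw [e, norm_mul, norm_sampledExp, one_mul]
  refine (Real.norm_exp_I_mul_ofReal_sub_one_le).trans ?_
  rw [Real.norm_eq_abs, abs_mul, abs_of_nonneg (by positivity)]
  have : (n : ℝ) ≤ N := by exact_mod_cast n.2.le
  gcongr

theorem norm_trigSum_sub_le {N : ℕ} (x : Fin N → ℂ) (f f' : ℝ) :
    ‖trigSum x f - trigSum x f'‖ ≤ 2 * Real.pi * N * |f - f'| * ∑ n, ‖x n‖ := by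
  rw [trigSum, trigSum, ← Finset.sum_sub_distrib, Finset.mul_sum]
  refine (norm_sum_le _ _).trans (Finset.sum_le_sum fun n _ => ?_)
  rw [← mul_sub, norm_mul, mul_comm]
  exact mul_le_mul_of_nonneg_right (norm_sampledExp_sub_le f f' n) (norm_nonneg _)

/-- If the band energy of a trigonometric polynomial is small relative to its total energy `R`,
then it cannot take the value `R` in the band unless `R` itself is small. -/
theorem sum_norm_sq_le_of_integral_le {N m : ℕ} {W ε f₀ : ℝ} (hN : 0 < N) (hW : 0 < W)
    (hε : 0 < ε) (hε1 : ε ≤ 1) (hm : 64 ≤ 9 ^ m * ε ^ 2) (x : Fin N → ℂ)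
    (hf : f₀ ∈ Set.Icc (-W) W) (hx : ‖trigSum x f₀‖ = ∑ n, ‖x n‖ ^ 2)
    (hint : ∫ f in (-W)..W, ‖trigSum x f‖ ^ 2 ≤
      (1 / 9) ^ m * min 1 (2 * N * W) * ∑ n, ‖x n‖ ^ 2) :
    ∑ n, ‖x n‖ ^ 2 ≤ ε * N := by
  by_contra! hR
  have hN' : (0 : ℝ) < N := by exact_mod_cast hN
  have hpi := Real.pi_pos
  set R := ∑ n, ‖x n‖ ^ 2 with hRdef
  set T := ∑ n, ‖x n‖ with hT
  have hR0 : 0 < R := lt_trans (by positivity) hR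
  have hT0 : 0 ≤ T := by positivity
  have hTsq : T ^ 2 ≤ N * R := by
    simpa using sq_sum_le_card_mul_sum_sq (s := Finset.univ) (f := fun n => ‖x n‖)
  -- Cauchy–Schwarz with the assumption `ε N < R` lets the Lipschitz constant `2πN T` be measured in
  -- units of `R`.
  have hεT : ε * T ≤ R := by
    refine le_of_sq_le_sq ?_ hR0.le
    calc (ε * T) ^ 2 = ε ^ 2 * T ^ 2 := by ring
      _ ≤ ε ^ 2 * (N * R) := by gcongr
      _ = ε * ((ε * N) * R) := by ring
      _ ≤ 1 * (R * R) := by gcongr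
      _ = R ^ 2 := by ring
  -- Over a distance `ε / (4πN)` the polynomial varies by at most `ε T / 2 ≤ R / 2`; the cap `W`
  -- lets a one-sided interval of length `h` at `f₀`, pointing towards `0`, fit in the band.
  set h := min W (ε / (4 * Real.pi * N)) with hh
  have hh0 : 0 < h := lt_min hW (by positivity)
  have hhW : h ≤ W := min_le_left _ _
  have hhε : h * (4 * Real.pi * N) ≤ ε := (le_div_iff₀ (by positivity)).1 (min_le_right _ _)
  have hlow : ∀ f : ℝ, |f - f₀| ≤ h → R / 2 ≤ ‖trigSum x f‖ := by
    intro f hf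
    have h1 := norm_trigSum_sub_le x f₀ f
    rw [abs_sub_comm] at h1
    have h2 : 2 * Real.pi * N * |f - f₀| * T ≤ R / 2 := by
      calc 2 * Real.pi * N * |f - f₀| * T ≤ 2 * Real.pi * N * h * T := by gcongr
        _ = (h * (4 * Real.pi * N)) * T / 2 := by ring
        _ ≤ ε * T / 2 := by gcongr
        _ ≤ R / 2 := by gcongr
    have h3 := norm_sub_norm_le (trigSum x f₀) (trigSum x f)
    rw [hx] at h3
    linarith
  obtain ⟨a, ha1, ha2, ha3⟩ : ∃ a, -W ≤ a ∧ a + h ≤ W ∧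
      ∀ f ∈ Set.Icc a (a + h), |f - f₀| ≤ h := by
    rcases le_total f₀ 0 with h0 | h0
    · exact ⟨f₀, hf.1, by linarith, fun f hf => abs_le.2 ⟨by linarith [hf.1], by linarith [hf.2]⟩⟩
    · exact ⟨f₀ - h, by linarith, by linarith [hf.2],
        fun f hf => abs_le.2 ⟨by linarith [hf.1], by linarith [hf.2]⟩⟩
  have hI1 : h * (R / 2) ^ 2 ≤ ∫ f in a..(a + h), ‖trigSum x f‖ ^ 2 := by
    have := intervalIntegral.integral_mono_on (a := a) (b := a + h) (μ := MeasureTheory.volume)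
      (f := fun _ => (R / 2) ^ 2) (by linarith) intervalIntegrable_const
      (intervalIntegrable_norm_sq_trigSum x _ _)
      fun f hf => pow_le_pow_left₀ (by positivity) (hlow f (ha3 f hf)) 2
    rw [intervalIntegral.integral_const, smul_eq_mul] at this
    linarith
  have hI2 : ∫ f in a..(a + h), ‖trigSum x f‖ ^ 2 ≤ ∫ f in (-W)..W, ‖trigSum x f‖ ^ 2 :=
    intervalIntegral.integral_mono_interval ha1 (by linarith) ha2
      (Filter.Eventually.of_forall fun f => by positivity)
      (intervalIntegrable_norm_sq_trigSum x _ _)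
  have hhR : h * R ≤ 4 * ((1 / 9) ^ m * min 1 (2 * N * W)) := by
    refine le_of_mul_le_mul_right ?_ hR0
    linarith
  have hmε : (1 / 9 : ℝ) ^ m ≤ ε ^ 2 / 64 := by
    rw [one_div, inv_pow, inv_le_iff_one_le_mul₀ (by positivity)]
    linarith
  have hcontr : h * (ε * N) < 4 * (ε ^ 2 / 64 * min 1 (2 * N * W)) := by
    have hmin : 0 ≤ min 1 (2 * N * W) := le_min zero_le_one (by positivity)
    calc h * (ε * N) < h * R := by gcongr
      _ ≤ _ := hhR
      _ ≤ _ := by gcongr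
  -- If `h = W`, the bound `2NW` cancels the factor `W`; otherwise the bound `1` suffices, using `π
  -- ≤ 4`.
  rcases min_choice W (ε / (4 * Real.pi * N)) with hc | hc
  · rw [hh, hc] at hcontr
    have h1 : 4 * (ε ^ 2 / 64 * min 1 (2 * N * W)) ≤ 4 * (ε ^ 2 / 64 * (2 * N * W)) := by
      gcongr; exact min_le_right _ _
    have h2 : 0 < N * W * ε := by positivity
    nlinarith
  · rw [hh, hc] at hcontr
    have h1 : 4 * (ε ^ 2 / 64 * min 1 (2 * N * W)) ≤ 4 * (ε ^ 2 / 64 * 1) := by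
      gcongr; exact min_le_left _ _
    have h2 : ε / (4 * Real.pi * N) * (ε * N) = ε ^ 2 / (4 * Real.pi) := by field_simp
    have h3 : ε ^ 2 / 16 ≤ ε ^ 2 / (4 * Real.pi) := by
      gcongr; linarith [Real.pi_le_four]
    linarith

/-! ### The projection residual -/

theorem toLp_sub_firstColumns_mulVec {N K : ℕ} (hK : K ≤ N)
    {s : Fin N → EuclideanSpace ℂ (Fin N)} (hs : Orthonormal ℂ s) (e : Fin N → ℂ) :
    (WithLp.toLp 2 (e - (firstColumns hK s * (firstColumns hK s)ᴴ) *ᵥ e) :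
        EuclideanSpace ℂ (Fin N)) =
      ∑ l : {l : Fin N // ¬ (l : ℕ) < K}, inner ℂ (s l) (WithLp.toLp 2 e) • s l := by
  have hcard : Fintype.card (Fin N) = Module.finrank ℂ (EuclideanSpace ℂ (Fin N)) := by simp
  have htop := hs.linearIndependent.span_eq_top_of_card_eq_finrank' hcard
  have hexp := (OrthonormalBasis.mk hs htop.ge).sum_repr' (WithLp.toLp 2 e)
  simp only [OrthonormalBasis.coe_mk] at hexp
  have hproj : (WithLp.toLp 2 ((firstColumns hK s * (firstColumns hK s)ᴴ) *ᵥ e) :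
      EuclideanSpace ℂ (Fin N)) =
        ∑ l ∈ Finset.univ.filter (fun l : Fin N => (l : ℕ) < K),
          inner ℂ (s l) (WithLp.toLp 2 e) • s l := by
    have hmap : Finset.univ.filter (fun l : Fin N => (l : ℕ) < K) =
        Finset.univ.map (Fin.castLEEmb hK) := by
      ext l
      simp only [Finset.mem_filter, Finset.mem_univ, true_and, Finset.mem_map,
        Fin.castLEEmb_apply]
      exact ⟨fun h => ⟨⟨l, h⟩, rfl⟩, by rintro ⟨k, rfl⟩; exact k.2⟩
    rw [hmap, Finset.sum_map]
    ext n
    rw [← Matrix.mulVec_mulVec, WithLp.ofLp_sum, Finset.sum_apply]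
    simp only [Matrix.mulVec, dotProduct, firstColumns, Matrix.of_apply,
      Matrix.conjTranspose_apply, PiLp.smul_apply, smul_eq_mul, Fin.castLEEmb_apply]
    refine Finset.sum_congr rfl fun k _ => ?_
    rw [mul_comm]
    congr 1
    rw [EuclideanSpace.inner_eq_star_dotProduct, dotProduct]
    exact Finset.sum_congr rfl fun _ _ => mul_comm _ _
  rw [WithLp.toLp_sub, hproj, sub_eq_iff_eq_add']
  refine hexp.symm.trans ?_
  rw [← Finset.sum_filter_add_sum_filter_not Finset.univ (fun l : Fin N => (l : ℕ) < K)]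
  congr 1
  exact Finset.sum_subtype _ (by simp) _

theorem l2norm_sq {N : ℕ} (x : Fin N → ℂ) : l2norm x ^ 2 = ∑ n, ‖x n‖ ^ 2 := by
  rw [l2norm, EuclideanSpace.norm_sq_eq]

theorem inner_sampledExp {N : ℕ} (f : ℝ) (x : EuclideanSpace ℂ (Fin N)) :
    inner ℂ (WithLp.toLp 2 (sampledExp N f)) x = trigSum x.ofLp (-f) := by
  rw [EuclideanSpace.inner_eq_star_dotProduct, dotProduct, trigSum]
  refine Finset.sum_congr rfl fun n _ => ?_
  congr 1
  simp only [Pi.star_apply, sampledExp_eq, star_def, ← exp_conj, map_mul, conj_ofReal, conj_I]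
  congr 1; push_cast; ring

/-- The relative residual of a sampled exponential after projection on the first `K` DPSS vectors
is small once `K` exceeds the dimension needed for the eigenvalue bound. -/
theorem residual_le {N J m K : ℕ} {W ε f : ℝ} (hN : 0 < N) (hJ : N ^ 2 < 2 ^ J) (hW : 0 < W)
    (hV : W + 1 / N < 1 / 2) (hε : 0 < ε) (hε1 : ε ≤ 1) (hm : 64 ≤ 9 ^ m * ε ^ 2)
    (hK : K < N) (hKm : m * J + (bandNodes N (W + 1 / N)).card ≤ K)
    {s : Fin N → EuclideanSpace ℂ (Fin N)} (hs : IsDPSS N W s) (hf : f ∈ Set.Icc (-W) W) :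
    l2norm (sampledExp N f -
      (firstColumns hK.le s * (firstColumns hK.le s)ᴴ) *ᵥ sampledExp N f) ^ 2 ≤ ε * N := by
  obtain ⟨hs, ν, hanti, hν⟩ := hs
  have hres := toLp_sub_firstColumns_mulVec hK.le hs (sampledExp N f)
  set x := sampledExp N f - (firstColumns hK.le s * (firstColumns hK.le s)ᴴ) *ᵥ sampledExp N f
  set c : {l : Fin N // ¬ (l : ℕ) < K} → ℂ :=
    fun l => inner ℂ (s l) (WithLp.toLp 2 (sampledExp N f)) with hc
  have hsι : Orthonormal ℂ fun l : {l : Fin N // ¬ (l : ℕ) < K} => s l :=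
    hs.comp _ Subtype.val_injective
  have hxc : x = (∑ l, c l • s l.1).ofLp := by rw [← hres]
  have hnorm : ∑ n, ‖x n‖ ^ 2 = ∑ l, ‖c l‖ ^ 2 := by
    rw [← hsι.norm_sq_sum_smul, ← hres, EuclideanSpace.norm_sq_eq]
  -- This is `⟨e_f, x⟩ = ‖x‖²`, as `x` is an orthogonal projection of `e_f`.
  have hval : trigSum x (-f) = ((∑ l, ‖c l‖ ^ 2 : ℝ) : ℂ) := by
    rw [hxc, ← inner_sampledExp, inner_sum]
    push_cast
    refine Finset.sum_congr rfl fun l _ => ?_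
    rw [inner_smul_right, ← inner_conj_symm, mul_conj']
  rw [l2norm_sq]
  refine sum_norm_sq_le_of_integral_le hN hW hε hε1 hm x (f₀ := -f)
    ⟨by linarith [hf.2], by linarith [hf.1]⟩ ?_ ?_
  · rw [hval, norm_real, Real.norm_of_nonneg (by positivity), hnorm]
  · rw [hnorm, hxc, integral_norm_sq_trigSum_eigenvectors hsι fun l => hν l, Finset.mul_sum]
    refine Finset.sum_le_sum fun l _ => ?_
    gcongr
    refine (hanti (show (⟨K, hK⟩ : Fin N) ≤ l.1 from ?_)).trans
      (dpss_eigenvalue_le hN hJ hW.le hV hs hanti hν (k := ⟨K, hK⟩) hKm)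
    exact not_lt.1 l.2

/-! ### Choice of parameters -/

theorem mainTheorem6 :
    ∃ C : ℝ, 0 < C ∧
      ∀ (N : ℕ), 2 ≤ N →
      ∀ (W : ℝ), W ∈ Set.Ioo (0 : ℝ) (1 / 2) →
      ∀ (ε : ℝ), ε ∈ Set.Ioo (0 : ℝ) (1 / 2) →
      ∃ (K : ℕ) (hK : K ≤ N),
        |(K : ℝ) - 2 * (N : ℝ) * W| ≤ C * (Real.log (N : ℝ) * Real.log (1 / ε ^ 2)) ∧
        ∀ (s : Fin N → EuclideanSpace ℂ (Fin N)), IsDPSS N W s →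
        ∀ (f : ℝ), f ∈ Set.Icc (-W) W →
          l2norm (sampledExp N f -
              (firstColumns hK s * (firstColumns hK s)ᴴ) *ᵥ sampledExp N f) ^ 2 /
            l2norm (sampledExp N f) ^ 2 ≤ ε := by
  -- `m J ≤ 5L * 6 log N` accounts for `30`; the rounding and margin in the node count cost at most
  -- `4`, absorbed through `log N * L ≥ 0.9`.
  refine ⟨40, by norm_num, fun N hN2 W ⟨hW0, hW⟩ ε ⟨hε0, hε⟩ => ?_⟩
  have hN : 0 < N := by omega
  have hN' : (0 : ℝ) < N := by exact_mod_cast hN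
  have hN2' : (2 : ℝ) ≤ N := by exact_mod_cast hN2
  have hlog2 := Real.log_two_gt_d9
  have hlogN : Real.log 2 ≤ Real.log N := Real.log_le_log two_pos hN2'
  set L := Real.log (1 / ε ^ 2) with hL
  have hL4 : 2 * Real.log 2 ≤ L := by
    rw [hL, show 2 * Real.log 2 = Real.log (2 ^ 2) by rw [Real.log_pow]; norm_num]
    refine Real.log_le_log (by norm_num) ?_
    rw [le_div_iff₀ (by positivity)]
    nlinarith
  obtain ⟨J, hJ, hJle⟩ : ∃ J : ℕ, N ^ 2 < 2 ^ J ∧ (J : ℝ) ≤ 6 * Real.log N := by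
    refine ⟨2 * (Nat.log 2 N + 1), ?_, ?_⟩
    · rw [mul_comm 2, pow_mul]
      exact Nat.pow_lt_pow_left (Nat.lt_pow_succ_log_self one_lt_two N) two_ne_zero
    · have h1 : ((2 ^ Nat.log 2 N : ℕ) : ℝ) ≤ N := by
        exact_mod_cast Nat.pow_log_le_self 2 hN.ne'
      have h2 := Real.log_le_log (by positivity) h1
      rw [Nat.cast_pow, Real.log_pow] at h2
      push_cast at h2 ⊢
      have h3 : (0 : ℝ) ≤ Nat.log 2 N := by positivity
      nlinarith
  obtain ⟨m, hm, hmle⟩ : ∃ m : ℕ, 64 ≤ 9 ^ m * ε ^ 2 ∧ (m : ℝ) ≤ 5 * L := by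
    -- As `L ≥ 2 log 2`, `exp (4L) ≥ 64 / ε²`, and `9 > e`. Also `L > 1` absorbs the rounding.
    refine ⟨⌈4 * L⌉₊, ?_, ?_⟩
    · have h1 := Nat.le_ceil (4 * L)
      have h2 : Real.exp (3 * (2 * Real.log 2) + L) ≤ 9 ^ ⌈4 * L⌉₊ := by
        calc Real.exp (3 * (2 * Real.log 2) + L) ≤ Real.exp (⌈4 * L⌉₊ : ℝ) :=
              Real.exp_le_exp.2 (by linarith)
          _ = Real.exp 1 ^ ⌈4 * L⌉₊ := by rw [← Real.exp_nat_mul, mul_one]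
          _ ≤ 9 ^ ⌈4 * L⌉₊ := by
            gcongr; linarith [Real.exp_one_lt_d9]
      have h3 : Real.exp (3 * (2 * Real.log 2) + L) = 64 * (1 / ε ^ 2) := by
        rw [Real.exp_add, hL, Real.exp_log (by positivity),
          show 3 * (2 * Real.log 2) = Real.log (2 ^ 6) by rw [Real.log_pow]; norm_num; ring,
          Real.exp_log (by positivity)]
        norm_num
      rw [h3, mul_one_div, div_le_iff₀ (by positivity)] at h2
      exact h2
    · have := Nat.ceil_lt_add_one (show 0 ≤ 4 * L by linarith)
      linarith
  set K₀ := m * J + 2 * ⌈N * (W + 1 / N)⌉₊ with hK₀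
  have hNW : N * (W + 1 / N) = N * W + 1 := by field_simp
  have hceil1 := Nat.le_ceil (N * (W + 1 / N))
  have hceil2 := Nat.ceil_lt_add_one (show 0 ≤ N * (W + 1 / N) by positivity)
  rw [hNW] at hceil1 hceil2
  have hK₀low : 2 * N * W + 2 ≤ (K₀ : ℝ) := by
    have : (0 : ℝ) ≤ m * J := by positivity
    rw [hK₀, hNW]; push_cast; linarith
  have hLL : 0.9 ≤ Real.log N * L := by nlinarith
  have hK₀up : (K₀ : ℝ) - 2 * N * W ≤ 40 * (Real.log N * L) := by
    have hL0 : 0 ≤ 5 * L := by linarith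
    have : (m : ℝ) * J ≤ 5 * L * (6 * Real.log N) := by gcongr
    rw [hK₀, hNW]; push_cast; linarith
  have hden : ∀ f : ℝ, l2norm (sampledExp N f) ^ 2 = N := by
    intro f; rw [l2norm_sq]; simp [norm_sampledExp]
  have hWN : 2 * N * W ≤ N := by nlinarith
  rcases lt_or_ge K₀ N with hlt | hge
  · refine ⟨K₀, hlt.le, ?_, fun s hs f hf => ?_⟩
    · rw [abs_of_nonneg (by linarith)]; exact hK₀up
    · rw [hden, div_le_iff₀ hN']
      -- `K₀ < N` already forces the enlarged band to be proper, since `K₀ ≥ 2N(W + 1 / N)`.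
      have hV : W + 1 / N < 1 / 2 := by
        have h1 : (K₀ : ℝ) < N := by exact_mod_cast hlt
        have h2 : N * (W + 1 / N) < N * (1 / 2) := by linarith
        exact lt_of_mul_lt_mul_left h2 hN'.le
      exact residual_le hN hJ hW0 hV hε0 (by linarith) hm hlt
        (by have := card_bandNodes_le hN (W + 1 / N); omega) hs hf
  -- With `K = N` the residual is zero, and `2NW ≤ N ≤ K₀` keeps `K` within the allowed distance.
  · refine ⟨N, le_rfl, ?_, fun s hs f _ => ?_⟩
    · have h1 : (N : ℝ) ≤ K₀ := by exact_mod_cast hge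
      rw [abs_of_nonneg (by linarith)]; linarith
    · have : IsEmpty {l : Fin N // ¬ (l : ℕ) < N} := ⟨fun l => l.2 l.1.2⟩
      rw [l2norm, toLp_sub_firstColumns_mulVec le_rfl hs.1, Finset.univ_eq_empty,
        Finset.sum_empty, norm_zero]
      simpa using hε0.le
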